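/- Let $[n]=\{1,\dots,n\}$. Fix $k$ and suppose that an unknown antichain $\mathcal S\subseteq 2^{[n]}$ (no member contains another) with exactly $k$ members is given. A query is a set $Q\subseteq[n]$; its answer is YES if $H\subseteq Q$ for at least one $H\in\mathcal S$, and NO otherwise. An adaptive algorithm is a finite binary decision tree whose inner nodes are labelled with queries, with one child for the answer YES and one for the answer NO; it identifies every antichain with $k$ members if along each root-to-leaf branch there is at most one antichain with $k$ members that is consistent with the answers. Let $f(n,k)$ be the smallest number of queries that are enough in the worst case, i.e. the least depth of such a decision tree that identifies every antichain with $k$ members in $2^{[n]}$. **Theorem.** For every fixed integer $k\ge 3$, $$f(n,k)=(1+o(1))\left(\frac{n}{k-1}\right)^{k-1}\qquad\text{as } n\to\infty .$$ -/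

import Mathlib

open Filter Asymptotics

/-- An adaptive query strategy on subsets of the `n`-element ground set `Fin n`: a binary tree whose
inner nodes are labelled with queries, with one subtree for the answer YES and one for NO. -/
inductive QueryTree (n : ℕ) : Type where
  | leaf : QueryTree n
  | query (Q : Finset (Fin n)) (yes no : QueryTree n) : QueryTree n

namespace QueryTree

variable {n : ℕ}

/-- The worst-case number of queries asked by the strategy. -/
def depth : QueryTree n → ℕ
  | leaf => 0
  | query _ yes no => max yes.depth no.depth + 1

/-- The root-to-leaf branches, each recorded as the list of its queries with their answers
(`true` is YES, `false` is NO). -/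
def branches : QueryTree n → Set (List (Finset (Fin n) × Bool))
  | leaf => {[]}
  | query Q yes no =>
      {b | ∃ c ∈ yes.branches, b = (Q, true) :: c} ∪ {b | ∃ c ∈ no.branches, b = (Q, false) :: c}

end QueryTree

/-- `S` is an antichain with exactly `k` members in the power set of `Fin n`. -/
def IsKAntichain {n : ℕ} (k : ℕ) (S : Finset (Finset (Fin n))) : Prop :=
  IsAntichain (· ⊆ ·) (S : Set (Finset (Fin n))) ∧ S.card = k

/-- All recorded answers are the true ones for the hidden family `S`: the answer to `Q` is YES
exactly if `Q` is a superset of at least one member of `S`. -/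
def IsConsistent {n : ℕ} (S : Finset (Finset (Fin n))) (b : List (Finset (Fin n) × Bool)) : Prop :=
  ∀ p ∈ b, (p.2 = true ↔ ∃ H ∈ S, H ⊆ p.1)

/-- The strategy `T` identifies every antichain with `k` members: along each branch there is at most
one such antichain that is consistent with the answers. -/
def QueryTree.Identifies {n : ℕ} (T : QueryTree n) (k : ℕ) : Prop :=
  ∀ b ∈ T.branches, ∀ S S' : Finset (Finset (Fin n)), IsKAntichain k S → IsKAntichain k S' →
    IsConsistent S b → IsConsistent S' b → S = S'

/-- The number `f(n, k)`: the least worst-case number of queries of an adaptive strategy that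
identifies every antichain with `k` members in the power set of an `n`-element set. -/
noncomputable def adaptiveQueryNumber (n k : ℕ) : ℕ :=
  sInf {d : ℕ | ∃ T : QueryTree n, T.Identifies k ∧ T.depth = d}

/-- The strategy that asks all the sets of a list, whatever the answers are. -/
def QueryTree.ofList {n : ℕ} : List (Finset (Fin n)) → QueryTree n
  | [] => QueryTree.leaf
  | Q :: l => QueryTree.query Q (QueryTree.ofList l) (QueryTree.ofList l)

theorem QueryTree.exists_mem_of_mem_branches_ofList {n : ℕ} (l : List (Finset (Fin n))) :
    ∀ b ∈ (QueryTree.ofList l).branches, ∀ Q ∈ l, ∃ a : Bool, (Q, a) ∈ b := by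
  induction l with
  | nil => intro b _ Q hQ; simp at hQ
  | cons R l ih =>
    intro b hb Q hQ
    rcases hb with ⟨c, hc, rfl⟩ | ⟨c, hc, rfl⟩ <;>
    · rcases List.mem_cons.1 hQ with rfl | h
      · exact ⟨_, List.mem_cons_self⟩
      · obtain ⟨a, ha⟩ := ih c hc Q h
        exact ⟨a, List.mem_cons_of_mem _ ha⟩

theorem IsKAntichain.subset_of_forall {n k : ℕ} {S S' : Finset (Finset (Fin n))}
    (hS : IsKAntichain k S)
    (h : ∀ Q : Finset (Fin n), (∃ H ∈ S, H ⊆ Q) ↔ ∃ H ∈ S', H ⊆ Q) : S ⊆ S' := by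
  intro A hA
  obtain ⟨B, hB, hBA⟩ := (h A).1 ⟨A, hA, subset_rfl⟩
  obtain ⟨C, hC, hCB⟩ := (h B).2 ⟨B, hB, subset_rfl⟩
  have hCA : C = A := hS.1.eq hC hA (hCB.trans hBA)
  subst hCA
  rwa [hCB.antisymm hBA]

/-- Some strategy identifies every antichain with `k` members, so the infimum that defines
`adaptiveQueryNumber` is a minimum. -/
theorem QueryTree.exists_identifies (n k : ℕ) : ∃ T : QueryTree n, T.Identifies k := by
  refine ⟨QueryTree.ofList (Finset.univ : Finset (Finset (Fin n))).toList, ?_⟩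
  intro b hb S S' hS hS' hc hc'
  have h : ∀ Q : Finset (Fin n), (∃ H ∈ S, H ⊆ Q) ↔ ∃ H ∈ S', H ⊆ Q := by
    intro Q
    obtain ⟨a, ha⟩ := QueryTree.exists_mem_of_mem_branches_ofList _ b hb Q (by simp)
    exact (hc _ ha).symm.trans (hc' _ ha)
  exact (hS.subset_of_forall h).antisymm (hS'.subset_of_forall fun Q => (h Q).symm)

/-! Upper bound: the members are learnt one by one. Let `K` be the set of known members. A further
member `H` contains none of them, so its complement meets each of them and includes a minimal
transversal `T` of `K`; hence `H ⊆ Tᶜ`. Asking `Tᶜ` for all minimal `T` therefore produces a YES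
(`exists_answersYes_compl`), and deleting elements one at a time shrinks that set to a new member
within `n` more queries (`separable_of_insert`). Each vertex of a minimal transversal has a private
edge, so `T` has at most `|K|` vertices. If it has exactly `|K| = k - 1`, it picks one private
vertex from each edge, and AM-GM bounds the number of such `T` by `(n/(k-1))^(k-1)`. Everything else
costs `O(n^(k-2))`, as `k ≥ 3`.

Lower bound: each candidate consists of `k - 1` fixed disjoint blocks of size `m = ⌊n/(k-1)⌋` and
the complement of one transversal of the blocks. A query that contains a block gets YES from every
candidate. Any other query contains at most one of the complements, so the answer NO eliminates at
most one of the `m^(k-1)` candidates (`exists_branch_consistent`). -/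

/-- The oracle for the hidden family `S` answers YES to `Q`. -/
def AnswersYes {n : ℕ} (S : Finset (Finset (Fin n))) (Q : Finset (Fin n)) : Prop :=
  ∃ H ∈ S, H ⊆ Q

/-- Some strategy of depth at most `d` tells the families of the class `C` apart. -/
def Separable {n : ℕ} (C : Set (Finset (Finset (Fin n)))) (d : ℕ) : Prop :=
  ∃ T : QueryTree n, T.depth ≤ d ∧ ∀ b ∈ T.branches, ∀ S ∈ C, ∀ S' ∈ C,
    IsConsistent S b → IsConsistent S' b → S = S'

/-! ### Building blocks of query strategies. -/

section Upper

variable {n : ℕ} {C D : Set (Finset (Finset (Fin n)))} {d e : ℕ}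

theorem Separable.mono (h : Separable C d) (hDC : D ⊆ C) (hde : d ≤ e) : Separable D e := by
  obtain ⟨T, hT, hs⟩ := h
  exact ⟨T, hT.trans hde, fun b hb S hS S' hS' => hs b hb S (hDC hS) S' (hDC hS')⟩

theorem Separable.of_subsingleton (h : C.Subsingleton) : Separable C d :=
  ⟨.leaf, Nat.zero_le _, fun _ _ _ hS _ hS' _ _ => h hS hS'⟩

theorem isConsistent_cons {S : Finset (Finset (Fin n))} {Q : Finset (Fin n)} {a : Bool}
    {b : List (Finset (Fin n) × Bool)} :
    IsConsistent S ((Q, a) :: b) ↔ (a = true ↔ AnswersYes S Q) ∧ IsConsistent S b :=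
  List.forall_mem_cons

/-- Asking one query. -/
theorem Separable.query (Q : Finset (Fin n)) (hy : Separable {S ∈ C | AnswersYes S Q} d)
    (hn : Separable {S ∈ C | ¬ AnswersYes S Q} d) : Separable C (d + 1) := by
  obtain ⟨Y, hYd, hY⟩ := hy
  obtain ⟨N, hNd, hN⟩ := hn
  refine ⟨.query Q Y N, Nat.succ_le_succ (max_le hYd hNd), ?_⟩
  rintro b (⟨c, hc, rfl⟩ | ⟨c, hc, rfl⟩) S hS S' hS' h h'
  · rw [isConsistent_cons] at h h'
    exact hY c hc S ⟨hS, h.1.1 rfl⟩ S' ⟨hS', h'.1.1 rfl⟩ h.2 h'.2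
  · rw [isConsistent_cons] at h h'
    exact hN c hc S ⟨hS, by simpa using h.1⟩ S' ⟨hS', by simpa using h'.1⟩ h.2 h'.2

/-- Going through a list of queries until the first answer YES. -/
theorem Separable.of_list (L : List (Finset (Fin n)))
    (hL : ∀ S ∈ C, ∃ Q ∈ L, AnswersYes S Q)
    (h : ∀ Q ∈ L, Separable {S ∈ C | AnswersYes S Q} d) : Separable C (L.length + d) := by
  induction L generalizing C with
  | nil =>
    refine .of_subsingleton fun S hS => ?_
    obtain ⟨Q, hQ, -⟩ := hL S hS
    simp at hQ
  | cons Q L ih =>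
    have e : (Q :: L).length + d = L.length + d + 1 := by simp; omega
    rw [e]
    refine .query Q ((h Q (by simp)).mono subset_rfl (by omega)) (ih ?_ ?_)
    · rintro S ⟨hS, hSQ⟩
      obtain ⟨R, hR, hSR⟩ := hL S hS
      rcases List.mem_cons.1 hR with rfl | hR
      · exact absurd hSR hSQ
      · exact ⟨R, hR, hSR⟩
    · exact fun R hR => (h R (by simp [hR])).mono (fun S hS => ⟨hS.1.1, hS.2⟩) le_rfl

/-- Shrinking a set with answer YES, element by element, to a member of the hidden family. -/
theorem Separable.of_shrink_list (l : List (Fin n)) (Q : Finset (Fin n))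
    (hQ : ∀ S ∈ C, AnswersYes S Q)
    (hl : ∀ x ∈ Q, x ∉ l → ∀ S ∈ C, ¬ AnswersYes S (Q.erase x))
    (h : ∀ A ⊆ Q, Separable {S ∈ C | A ∈ S} d) : Separable C (l.length + d) := by
  induction l generalizing C Q with
  | nil =>
    refine (h Q subset_rfl).mono (fun S hS => ⟨hS, ?_⟩) (by simp)
    -- No element of `Q` is dispensable any more, so a member inside `Q` must be all of `Q`.
    obtain ⟨H, hH, hHQ⟩ := hQ S hS
    suffices H = Q from this ▸ hH
    refine hHQ.antisymm fun x hx => by_contra fun hxH => ?_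
    exact hl x hx (by simp) S hS ⟨H, hH, Finset.subset_erase.2 ⟨hHQ, hxH⟩⟩
  | cons x l ih =>
    have e : (x :: l).length + d = l.length + d + 1 := by simp; omega
    rw [e]
    -- On YES, `x` is dropped. On NO, it stays for good: answers are monotone in the query, so an
    -- indispensable element remains indispensable when `Q` shrinks further.
    refine .query (Q.erase x) (ih (Q.erase x) (fun S hS => hS.2) ?_ ?_)
      (ih Q (fun S hS => hQ S hS.1) ?_ ?_)
    · rintro y hy hyl S ⟨hS, -⟩ ⟨H, hH, hHy⟩
      obtain ⟨hyx, hyQ⟩ := Finset.mem_erase.1 hy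
      exact hl y hyQ (by simp [hyx, hyl]) S hS
        ⟨H, hH, hHy.trans (Finset.erase_subset_erase y (Finset.erase_subset x Q))⟩
    · exact fun A hA => (h A (hA.trans (Finset.erase_subset x Q))).mono
        (fun S hS => ⟨hS.1.1, hS.2⟩) le_rfl
    · rintro y hy hyl S ⟨hS, hSx⟩
      rcases eq_or_ne y x with rfl | hyx
      · exact hSx
      · exact hl y hy (by simp [hyx, hyl]) S hS
    · exact fun A hA => (h A hA).mono (fun S hS => ⟨hS.1.1, hS.2⟩) le_rfl

theorem Separable.of_shrink (Q : Finset (Fin n)) (hQ : ∀ S ∈ C, AnswersYes S Q)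
    (h : ∀ A ⊆ Q, Separable {S ∈ C | A ∈ S} d) : Separable C (n + d) := by
  have := Separable.of_shrink_list (List.finRange n) Q hQ (by simp) h
  rwa [List.length_finRange] at this

end Upper

/-! ### Minimal transversals and their number. -/

/-- The sets that meet every member of `K`. -/
def IsTransversal {n : ℕ} (K : Finset (Finset (Fin n))) (T : Finset (Fin n)) : Prop :=
  ∀ H ∈ K, ∃ x ∈ H, x ∈ T

open Classical in
/-- The inclusion-minimal transversals of `K`. -/
noncomputable def minimalTransversals {n : ℕ} (K : Finset (Finset (Fin n))) :
    Finset (Finset (Fin n)) :=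
  {T | Minimal (IsTransversal K) T}

section Transversals

variable {n : ℕ} {K : Finset (Finset (Fin n))} {T : Finset (Fin n)}

theorem mem_minimalTransversals :
    T ∈ minimalTransversals K ↔ Minimal (IsTransversal K) T := by
  simp [minimalTransversals]

theorem IsTransversal.exists_minimal (h : IsTransversal K T) :
    ∃ M ∈ minimalTransversals K, M ⊆ T := by
  obtain ⟨M, hMT, hM⟩ := exists_minimal_le_of_wellFoundedLT (IsTransversal K) T h
  exact ⟨M, mem_minimalTransversals.2 hM, hMT⟩

/-- Every vertex of a minimal transversal is the only one in some edge. -/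
theorem exists_private_edge (hT : Minimal (IsTransversal K) T) {x : Fin n} (hx : x ∈ T) :
    ∃ H ∈ K, H ∩ T = {x} := by
  by_contra! hcon
  -- If no edge meets `T` in `x` alone, every edge through `x` meets `T` elsewhere too, and `x`
  -- could be dropped.
  have : IsTransversal K (T.erase x) := by
    intro H hH
    obtain ⟨y, hyH, hyT⟩ := hT.prop H hH
    by_cases hyx : y = x
    · subst hyx
      by_contra! hno
      refine hcon H hH ?_
      ext z
      simp only [Finset.mem_inter, Finset.mem_singleton]
      refine ⟨fun ⟨hzH, hzT⟩ => by_contra fun hzy => ?_, ?_⟩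
      · exact hno z hzH (Finset.mem_erase.2 ⟨hzy, hzT⟩)
      · rintro rfl; exact ⟨hyH, hyT⟩
    · exact ⟨y, hyH, Finset.mem_erase.2 ⟨hyx, hyT⟩⟩
  exact Finset.notMem_erase x T (hT.le_of_le this (Finset.erase_subset x T) hx)

/-- A choice of private edges, one for each vertex of a minimal transversal. -/
theorem exists_private_edge_map (hT : Minimal (IsTransversal K) T) :
    ∃ g : Fin n → Finset (Fin n), (∀ x ∈ T, g x ∈ K ∧ g x ∩ T = {x}) ∧ Set.InjOn g T := by
  choose! g hgK hg using fun (x : Fin n) (hx : x ∈ T) => exists_private_edge hT hx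
  refine ⟨g, fun x hx => ⟨hgK x hx, hg x hx⟩, fun x hx y hy hxy => ?_⟩
  have := hg x hx
  rw [hxy, hg y hy] at this
  exact (Finset.singleton_injective this).symm

theorem card_le_of_minimal (hT : Minimal (IsTransversal K) T) : T.card ≤ K.card := by
  obtain ⟨g, hg, hinj⟩ := exists_private_edge_map hT
  exact Finset.card_le_card_of_injOn g (fun x hx => (hg x hx).1) hinj

/-- There are at most `(n + 1) ^ j` sets of size at most `j`. -/
theorem card_filter_card_le (n j : ℕ) :
    (Finset.univ.filter fun T : Finset (Fin n) => T.card ≤ j).card ≤ (n + 1) ^ j := by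
  -- Sets are coded by words of length `j`; the letter `none` pads those with fewer than `j`
  -- elements.
  let F : (Fin j → Option (Fin n)) → Finset (Fin n) := fun g =>
    Finset.univ.filter fun x => ∃ i, g i = some x
  have hsub : (Finset.univ.filter fun T : Finset (Fin n) => T.card ≤ j) ⊆
      Finset.univ.image F := by
    intro T hT
    have hT : T.card ≤ j := by simpa using hT
    refine Finset.mem_image.2
      ⟨fun i => if h : i.1 < T.card then some (T.equivFin.symm ⟨i, h⟩).1 else none,
        Finset.mem_univ _, ?_⟩
    ext x
    simp only [F, Finset.mem_filter, Finset.mem_univ, true_and]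
    constructor
    · rintro ⟨i, hi⟩
      split_ifs at hi with h
      · obtain rfl := Option.some.inj hi
        exact Subtype.prop _
    · intro hx
      have h := (T.equivFin ⟨x, hx⟩).2
      exact ⟨⟨T.equivFin ⟨x, hx⟩, h.trans_le hT⟩, by simp⟩
  refine (Finset.card_le_card hsub).trans (Finset.card_image_le.trans ?_)
  simp

theorem card_minimalTransversals_le : (minimalTransversals K).card ≤ (n + 1) ^ K.card := by
  refine le_trans (Finset.card_le_card fun T hT => ?_) (card_filter_card_le n K.card)
  simpa using card_le_of_minimal (mem_minimalTransversals.1 hT)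

/-- The vertices that lie in the edge `H` of `K` and in no other edge. -/
def privateVertices (K : Finset (Finset (Fin n))) (H : Finset (Fin n)) : Finset (Fin n) :=
  H.filter fun x => ∀ H' ∈ K, x ∈ H' → H' = H

theorem sum_card_privateVertices_le : ∑ H ∈ K, (privateVertices K H).card ≤ n := by
  rw [← Finset.card_biUnion]
  · exact (Finset.card_le_univ _).trans (by simp)
  · intro H hH H' _ hne
    refine Finset.disjoint_left.2 fun x hx hx' => hne ?_
    rw [privateVertices, Finset.mem_filter] at hx hx'
    exact hx'.2 H hH hx.1

/-- The private parts of distinct edges are disjoint, so their sizes sum to at most `n` and AM-GM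
applies. This is the source of the main term. -/
theorem prod_card_privateVertices_le :
    (∏ H ∈ K, ((privateVertices K H).card : ℝ)) ≤ ((n : ℝ) / K.card) ^ K.card := by
  rcases K.eq_empty_or_nonempty with rfl | hK
  · simp
  have hK0 : (0 : ℝ) < K.card := by exact_mod_cast hK.card_pos
  have h := Real.geom_mean_le_arith_mean K (fun _ => 1)
    (fun H => ((privateVertices K H).card : ℝ)) (by simp) (by simpa using hK) (by simp)
  simp only [Real.rpow_one, one_mul, Finset.sum_const, nsmul_eq_mul, mul_one] at h
  have hs : ∑ H ∈ K, ((privateVertices K H).card : ℝ) ≤ n := by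
    exact_mod_cast sum_card_privateVertices_le (K := K)
  have h0 : (0 : ℝ) ≤ ∏ H ∈ K, ((privateVertices K H).card : ℝ) := by positivity
  rw [← Real.rpow_inv_natCast_pow h0 hK.card_pos.ne']
  exact pow_le_pow_left₀ (by positivity) (h.trans (by gcongr)) _

/-- A minimal transversal with as many vertices as `K` has edges uses private vertices only. -/
theorem exists_mem_pi_of_card_eq (hT : Minimal (IsTransversal K) T) (hc : T.card = K.card) :
    ∃ p ∈ K.pi (privateVertices K), T = K.attach.image fun H => p H.1 H.2 := by
  obtain ⟨g, hg, hinj⟩ := exists_private_edge_map hT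
  -- Equal cardinalities turn the injection `g` into a bijection from `T` onto `K`, so every edge
  -- meets `T` in a single vertex.
  have him : T.image g = K := by
    refine Finset.eq_of_subset_of_card_le (Finset.image_subset_iff.2 fun x hx => (hg x hx).1) ?_
    rw [Finset.card_image_of_injOn hinj, hc]
  have hex : ∀ H ∈ K, ∃ x ∈ T, g x = H := fun H hH => by
    rw [← him] at hH
    simpa using hH
  choose p hpT hp using hex
  refine ⟨p, Finset.mem_pi.2 fun H hH => ?_, ?_⟩
  · have h1 : H ∩ T = {p H hH} := by
      have := (hg _ (hpT H hH)).2
      rwa [hp H hH] at this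
    refine Finset.mem_filter.2
      ⟨(Finset.mem_inter.1 (h1 ▸ Finset.mem_singleton_self (p H hH))).1, fun H' hH' hx => ?_⟩
    have h2 : H' ∩ T = {p H' hH'} := by
      have := (hg _ (hpT H' hH')).2
      rwa [hp H' hH'] at this
    have h3 : p H hH = p H' hH' := by
      have : p H hH ∈ H' ∩ T := Finset.mem_inter.2 ⟨hx, hpT H hH⟩
      rwa [h2, Finset.mem_singleton] at this
    rw [← hp H hH, ← hp H' hH', h3]
  · ext x
    simp only [Finset.mem_image, Finset.mem_attach, true_and, Subtype.exists]
    constructor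
    · intro hx
      refine ⟨g x, (hg x hx).1, hinj (hpT _ _) hx (hp _ _)⟩
    · rintro ⟨H, hH, rfl⟩
      exact hpT H hH

/-- Transversals with `r + 1` vertices are choices of one private vertex per edge; all others have
at most `r` vertices, where a crude count is of lower order. -/
theorem card_minimalTransversals_le_div {r : ℕ} (hr : K.card = r + 1) :
    ((minimalTransversals K).card : ℝ) ≤
      ((n : ℝ) / (r + 1)) ^ (r + 1) + ((n : ℝ) + 1) ^ r := by
  have hsub : minimalTransversals K ⊆
      ((K.pi (privateVertices K)).image fun p => K.attach.image fun H => p H.1 H.2) ∪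
        Finset.univ.filter fun T : Finset (Fin n) => T.card ≤ r := by
    intro T hT
    have hT := mem_minimalTransversals.1 hT
    rcases (card_le_of_minimal hT).eq_or_lt with h | h
    · obtain ⟨p, hp, rfl⟩ := exists_mem_pi_of_card_eq hT h
      exact Finset.mem_union_left _ (Finset.mem_image_of_mem _ hp)
    · exact Finset.mem_union_right _ (by simp; omega)
  have h1 := (Finset.card_le_card hsub).trans (Finset.card_union_le _ _)
  have h2 := h1.trans (add_le_add Finset.card_image_le (card_filter_card_le n r))
  rw [Finset.card_pi] at h2
  have h3 := prod_card_privateVertices_le (K := K)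
  rw [hr] at h3
  have h4 : ((minimalTransversals K).card : ℝ) ≤
      (∏ H ∈ K, ((privateVertices K H).card : ℝ)) + ((n : ℝ) + 1) ^ r := by exact_mod_cast h2
  push_cast at h3
  linarith

end Transversals

/-! ### The learning strategy and the upper bound. -/

section Learning

variable {n k d : ℕ} {K : Finset (Finset (Fin n))}

/-- The complement of some minimal transversal of the known members contains a further member. -/
theorem exists_answersYes_compl {S : Finset (Finset (Fin n))} (hS : IsKAntichain k S)
    (hKS : K ⊆ S) (hk : K.card < k) : ∃ T ∈ minimalTransversals K, AnswersYes S Tᶜ := by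
  obtain ⟨H, hHS, hHK⟩ := Finset.exists_mem_notMem_of_card_lt_card (hk.trans_eq hS.2.symm)
  have hT : IsTransversal K Hᶜ := by
    intro H' hH'
    have : ¬ H' ⊆ H := fun h => hHK (hS.1.eq (hKS hH') hHS h ▸ hH')
    obtain ⟨x, hx, hxH⟩ := Finset.not_subset.1 this
    exact ⟨x, hx, Finset.mem_compl.2 hxH⟩
  obtain ⟨T, hTm, hTH⟩ := hT.exists_minimal
  exact ⟨T, hTm, H, hHS, by rwa [Finset.subset_compl_comm]⟩

/-- Learning one more member of the hidden antichain. -/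
theorem separable_of_insert (hk : K.card < k)
    (h : ∀ A ∉ K, Separable {S | IsKAntichain k S ∧ insert A K ⊆ S} d) :
    Separable {S | IsKAntichain k S ∧ K ⊆ S} ((minimalTransversals K).card + (n + d)) := by
  have hlen : (minimalTransversals K).card =
      ((minimalTransversals K).toList.map fun T => Tᶜ).length := by simp
  rw [hlen]
  refine .of_list _ ?_ ?_
  · rintro S ⟨hS, hKS⟩
    obtain ⟨T, hT, hST⟩ := exists_answersYes_compl hS hKS hk
    exact ⟨Tᶜ, List.mem_map.2 ⟨T, Finset.mem_toList.2 hT, rfl⟩, hST⟩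
  · intro Q hQ
    obtain ⟨T, hT, rfl⟩ := List.mem_map.1 hQ
    have hT := (mem_minimalTransversals.1 (Finset.mem_toList.1 hT)).prop
    refine .of_shrink Tᶜ (fun S hS => hS.2) fun A hA => ?_
    -- The set found is new: it avoids `T`, whereas every known member meets `T`.
    have hAK : A ∉ K := fun hAK => by
      obtain ⟨x, hxA, hxT⟩ := hT A hAK
      exact Finset.mem_compl.1 (hA hxA) hxT
    exact (h A hAK).mono (fun S hS => ⟨hS.1.1.1, Finset.insert_subset hS.2 hS.1.1.2⟩) le_rfl

theorem separable_of_card_eq (hK : K.card = k) :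
    Separable {S | IsKAntichain k S ∧ K ⊆ S} d := by
  have key : ∀ S, IsKAntichain k S → K ⊆ S → K = S := fun S hS hKS =>
    Finset.eq_of_subset_of_card_le hKS (by rw [hS.2, hK])
  exact .of_subsingleton fun S hS S' hS' => (key S hS.1 hS.2).symm.trans (key S' hS'.1 hS'.2)

/-- Only the search for the last member, with `r + 1` members known, needs the sharp bound `N`. In
each of the `m` earlier rounds at most `r` members are known and the crude bound `(n + 1) ^ r`
suffices. Every round adds `n` for shrinking. -/
theorem separable_of_card_add_eq {r N : ℕ}
    (hN : ∀ K : Finset (Finset (Fin n)), K.card = r + 1 → (minimalTransversals K).card ≤ N)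
    (m : ℕ) (hK : K.card + m = r + 1) :
    Separable {S | IsKAntichain (r + 2) S ∧ K ⊆ S} (N + n + m * ((n + 1) ^ r + n)) := by
  induction m generalizing K with
  | zero =>
    refine (separable_of_insert (d := 0) (by omega) fun A hA =>
      separable_of_card_eq (by rw [Finset.card_insert_of_notMem hA]; omega)).mono subset_rfl ?_
    have := hN K hK
    omega
  | succ m ih =>
    refine (separable_of_insert (by omega) fun A hA =>
      ih (by rw [Finset.card_insert_of_notMem hA]; omega)).mono subset_rfl ?_
    have h1 : (minimalTransversals K).card ≤ (n + 1) ^ r :=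
      card_minimalTransversals_le.trans (Nat.pow_le_pow_right (by omega) (by omega))
    rw [Nat.succ_mul]
    omega

theorem Separable.adaptiveQueryNumber_le (h : Separable {S | IsKAntichain (n := n) k S} d) :
    adaptiveQueryNumber n k ≤ d := by
  obtain ⟨T, hT, hs⟩ := h
  have hid : T.Identifies k := fun b hb S S' hS hS' => hs b hb S hS S' hS'
  exact (Nat.sInf_le (show T.depth ∈ {d | ∃ T : QueryTree n, T.Identifies k ∧ T.depth = d} from
    ⟨T, hid, rfl⟩)).trans hT

theorem adaptiveQueryNumber_le (n : ℕ) {r : ℕ} (hr : 1 ≤ r) :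
    (adaptiveQueryNumber n (r + 2) : ℝ) ≤
      ((n : ℝ) / (r + 1)) ^ (r + 1) + (2 * r + 4) * ((n : ℝ) + 1) ^ r := by
  set B : ℝ := ((n : ℝ) / (r + 1)) ^ (r + 1) + ((n : ℝ) + 1) ^ r with hB
  have hN : ∀ K : Finset (Finset (Fin n)), K.card = r + 1 →
      (minimalTransversals K).card ≤ ⌊B⌋₊ :=
    fun K hK => Nat.le_floor (card_minimalTransversals_le_div hK)
  have h := (separable_of_card_add_eq (K := ∅) hN (r + 1) (by simp)).mono
    (D := {S | IsKAntichain (r + 2) S}) (fun S hS => ⟨hS, by simp⟩) le_rfl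
  have h1 : (adaptiveQueryNumber n (r + 2) : ℝ) ≤
      ⌊B⌋₊ + n + (r + 1) * (((n : ℝ) + 1) ^ r + n) := by
    exact_mod_cast h.adaptiveQueryNumber_le
  have h2 : (⌊B⌋₊ : ℝ) ≤ B := Nat.floor_le (by positivity)
  -- For `r ≥ 1` the shrinking cost is absorbed. The multiples of `(n + 1) ^ r` are one from `B`,
  -- one from the last shrinking and `2 * (r + 1)` from the earlier rounds.
  have h3 : (n : ℝ) ≤ ((n : ℝ) + 1) ^ r := by
    exact_mod_cast n.le_succ.trans (Nat.le_self_pow (by omega) (n + 1))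
  have h4 : (r : ℝ) * n ≤ r * ((n : ℝ) + 1) ^ r := by gcongr
  linarith

end Learning

/-! ### The adversary argument for the lower bound. -/

section LowerBound

variable {n m r : ℕ}

/-- The block with index `i` of a family of disjoint blocks in the ground set. -/
def block (e : Fin (r + 1) × Fin m ↪ Fin n) (i : Fin (r + 1)) : Finset (Fin n) :=
  Finset.univ.image fun a => e (i, a)

/-- The complement of the transversal `t` of the blocks. -/
def cotransversal (e : Fin (r + 1) × Fin m ↪ Fin n) (t : Fin (r + 1) → Fin m) :
    Finset (Fin n) :=
  (Finset.univ.image fun i => e (i, t i))ᶜ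

/-- All blocks together with the complement of the transversal `t`. -/
def blockFamily (e : Fin (r + 1) × Fin m ↪ Fin n) (t : Fin (r + 1) → Fin m) :
    Finset (Finset (Fin n)) :=
  insert (cotransversal e t) (Finset.univ.image (block e))

variable {e : Fin (r + 1) × Fin m ↪ Fin n} {t t' : Fin (r + 1) → Fin m}

theorem mem_block {i j : Fin (r + 1)} {a : Fin m} : e (j, a) ∈ block e i ↔ j = i := by
  simp [block, eq_comm]

theorem mem_cotransversal {i : Fin (r + 1)} {a : Fin m} :
    e (i, a) ∈ cotransversal e t ↔ t i ≠ a := by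
  simp [cotransversal]

theorem block_subset_iff {i : Fin (r + 1)} {Q : Finset (Fin n)} :
    block e i ⊆ Q ↔ ∀ a, e (i, a) ∈ Q := by
  simp [block, Finset.subset_iff]

theorem mem_blockFamily {H : Finset (Fin n)} :
    H ∈ blockFamily e t ↔ H = cotransversal e t ∨ ∃ i, block e i = H := by
  simp [blockFamily]

theorem block_not_subset_cotransversal (i : Fin (r + 1)) :
    ¬ block e i ⊆ cotransversal e t := fun h =>
  mem_cotransversal.1 (h (mem_block.2 rfl : e (i, t i) ∈ block e i)) rfl

theorem cotransversal_not_subset_block (hr : 1 ≤ r) (hm : 2 ≤ m) (i : Fin (r + 1)) :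
    ¬ cotransversal e t ⊆ block e i := by
  intro h
  -- `1 ≤ r` gives a second block, and `2 ≤ m` gives a point in it off the transversal.
  have : Nontrivial (Fin (r + 1)) := Fin.nontrivial_iff_two_le.2 (by omega)
  have : Nontrivial (Fin m) := Fin.nontrivial_iff_two_le.2 hm
  obtain ⟨j, hj⟩ := exists_ne i
  obtain ⟨a, ha⟩ := exists_ne (t j)
  exact hj (mem_block.1 (h (mem_cotransversal.2 ha.symm)))

theorem block_subset_block (hm : 2 ≤ m) {i j : Fin (r + 1)} (h : block e i ⊆ block e j) :
    i = j :=
  mem_block.1 (block_subset_iff.1 h ⟨0, by omega⟩)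

theorem isKAntichain_blockFamily (hr : 1 ≤ r) (hm : 2 ≤ m) :
    IsKAntichain (r + 2) (blockFamily e t) := by
  constructor
  · intro H hH H' hH' hne hsub
    rcases mem_blockFamily.1 hH with rfl | ⟨i, rfl⟩ <;>
      rcases mem_blockFamily.1 hH' with rfl | ⟨j, rfl⟩
    · exact hne rfl
    · exact cotransversal_not_subset_block hr hm j hsub
    · exact block_not_subset_cotransversal i hsub
    · exact hne (block_subset_block hm hsub ▸ rfl)
  · rw [blockFamily, Finset.card_insert_of_notMem, Finset.card_image_of_injective]
    · simp
    · exact fun i j h => block_subset_block hm h.subset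
    · simp only [Finset.mem_image, Finset.mem_univ, true_and, not_exists]
      exact fun i h => block_not_subset_cotransversal i h.subset

/-- `Q` misses a point of every block, and a transversal whose complement lies in `Q` has to pass
through each missed point. -/
theorem eq_of_cotransversal_subset {Q : Finset (Fin n)} (hQ : ∀ i, ¬ block e i ⊆ Q)
    (h : cotransversal e t ⊆ Q) (h' : cotransversal e t' ⊆ Q) : t = t' := by
  funext i
  obtain ⟨a, ha⟩ := not_forall.1 (mt block_subset_iff.2 (hQ i))
  have key : ∀ u : Fin (r + 1) → Fin m, cotransversal e u ⊆ Q → u i = a := fun u hu =>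
    by_contra fun hne => ha (hu (mem_cotransversal.2 hne))
  rw [key t h, key t' h']

theorem blockFamily_injective (hr : 1 ≤ r) (hm : 2 ≤ m) :
    Function.Injective (blockFamily e) := by
  intro t t' h
  have hmem : cotransversal e t ∈ blockFamily e t' := h ▸ mem_blockFamily.2 (.inl rfl)
  rcases mem_blockFamily.1 hmem with h | ⟨i, hi⟩
  · exact eq_of_cotransversal_subset (fun i => block_not_subset_cotransversal i) subset_rfl h.ge
  · exact absurd hi.ge (cotransversal_not_subset_block hr hm i)

/-- The adversary: each query eliminates at most one of the candidates `blockFamily e t`. -/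
theorem exists_branch_consistent (e : Fin (r + 1) × Fin m ↪ Fin n) (T : QueryTree n)
    (A : Finset (Fin (r + 1) → Fin m)) :
    ∃ b ∈ T.branches, ∃ A' ⊆ A, A.card ≤ A'.card + T.depth ∧
      ∀ t ∈ A', IsConsistent (blockFamily e t) b := by
  classical
  induction T generalizing A with
  | leaf => exact ⟨[], rfl, A, subset_rfl, le_rfl, fun t _ => by simp [IsConsistent]⟩
  | query Q Y N ihY ihN =>
    -- The adversary answers YES exactly if `Q` contains a block, which is right for all candidates.
    -- Otherwise NO is wrong only for a candidate whose cotransversal lies in `Q`, and there is at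
    -- most one.
    by_cases hQ : ∃ i, block e i ⊆ Q
    · obtain ⟨i, hi⟩ := hQ
      obtain ⟨b, hb, A', hA', hc, h⟩ := ihY A
      refine ⟨(Q, true) :: b, .inl ⟨b, hb, rfl⟩, A', hA', ?_, fun t ht => ?_⟩
      · have := le_max_left Y.depth N.depth
        simp only [QueryTree.depth]
        omega
      · exact isConsistent_cons.2
          ⟨by simpa using ⟨_, mem_blockFamily.2 (.inr ⟨i, rfl⟩), hi⟩, h t ht⟩
    · push Not at hQ
      obtain ⟨b, hb, A', hA', hc, h⟩ := ihN (A.filter fun t => ¬ cotransversal e t ⊆ Q)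
      refine ⟨(Q, false) :: b, .inr ⟨b, hb, rfl⟩, A', hA'.trans (Finset.filter_subset _ _), ?_,
        fun t ht => isConsistent_cons.2 ⟨?_, h t ht⟩⟩
      · have h1 : (A.filter fun t => cotransversal e t ⊆ Q).card ≤ 1 :=
          Finset.card_le_one.2 fun t ht t' ht' => eq_of_cotransversal_subset hQ
            (Finset.mem_filter.1 ht).2 (Finset.mem_filter.1 ht').2
        have h2 := Finset.card_filter_add_card_filter_not (s := A)
          (fun t => cotransversal e t ⊆ Q)
        have := le_max_right Y.depth N.depth
        simp only [QueryTree.depth]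
        omega
      · have ht := (Finset.mem_filter.1 (hA' ht)).2
        suffices ¬ AnswersYes (blockFamily e t) Q by simpa using this
        rintro ⟨H, hH, hHQ⟩
        rcases mem_blockFamily.1 hH with rfl | ⟨i, rfl⟩
        · exact ht hHQ
        · exact hQ i hHQ

/-- The adversary starts with all `m ^ (r + 1)` transversals and loses at most one per query; an
identifying strategy may leave one survivor, hence the `+ 1`. -/
theorem pow_le_adaptiveQueryNumber_add_one (hr : 1 ≤ r) (hm : 2 ≤ m) (hn : (r + 1) * m ≤ n) :
    m ^ (r + 1) ≤ adaptiveQueryNumber n (r + 2) + 1 := by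
  obtain ⟨T₀, hT₀⟩ := QueryTree.exists_identifies n (r + 2)
  obtain ⟨T, hT, hd⟩ := Nat.sInf_mem
    (⟨_, T₀, hT₀, rfl⟩ : {d : ℕ | ∃ T : QueryTree n, T.Identifies (r + 2) ∧ T.depth = d}.Nonempty)
  obtain ⟨e⟩ : Nonempty (Fin (r + 1) × Fin m ↪ Fin n) :=
    Function.Embedding.nonempty_of_card_le (by simpa using hn)
  obtain ⟨b, hb, A, -, hc, h⟩ := exists_branch_consistent e T Finset.univ
  have h1 : A.card ≤ 1 := Finset.card_le_one.2 fun t ht t' ht' =>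
    blockFamily_injective hr hm <| hT b hb _ _ (isKAntichain_blockFamily hr hm)
      (isKAntichain_blockFamily hr hm) (h t ht) (h t' ht')
  rw [Finset.card_univ, Fintype.card_fun, Fintype.card_fin, Fintype.card_fin] at hc
  rw [adaptiveQueryNumber, ← hd]
  omega

end LowerBound

/-! ### Comparison with the main term and the limit. -/

theorem le_adaptiveQueryNumber_div {n r : ℕ} (hr : 1 ≤ r) (hn : 2 * (r + 1) ≤ n) :
    (1 - ((r : ℝ) + 1) / n) ^ (r + 1) - (((r : ℝ) + 1) / n) ^ (r + 1) ≤
      adaptiveQueryNumber n (r + 2) / ((n : ℝ) / (r + 1)) ^ (r + 1) := by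
  have hn0 : (0 : ℝ) < n := by exact_mod_cast (by omega : 0 < n)
  have hm : 2 ≤ n / (r + 1) := (Nat.le_div_iff_mul_le (by omega)).2 hn
  have h := pow_le_adaptiveQueryNumber_add_one hr hm (Nat.mul_div_le n (r + 1))
  have h1 : ((n / (r + 1) : ℕ) : ℝ) ^ (r + 1) ≤ adaptiveQueryNumber n (r + 2) + 1 := by
    exact_mod_cast h
  have h2 : (n : ℝ) / (r + 1) - 1 ≤ ((n / (r + 1) : ℕ) : ℝ) := by
    have : (n : ℝ) < ((n / (r + 1) : ℕ) + 1) * (r + 1) := by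
      exact_mod_cast Nat.lt_mul_of_div_lt (Nat.lt_succ_self _) (by omega)
    have := (div_lt_iff₀ (by positivity : (0 : ℝ) < r + 1)).2 this
    linarith
  have h3 : (0 : ℝ) ≤ (n : ℝ) / (r + 1) - 1 := by
    rw [sub_nonneg, le_div_iff₀ (by positivity), one_mul]
    exact_mod_cast (by omega : r + 1 ≤ n)
  have h4 := (pow_le_pow_left₀ h3 h2 (r + 1)).trans h1
  -- The first power accounts for rounding `n / (r + 1)` down; the subtracted one is the `+ 1` of
  -- `h1` divided by the main term.
  rw [le_div_iff₀ (by positivity), sub_mul, ← mul_pow, ← mul_pow]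
  have h5 : (1 - ((r : ℝ) + 1) / n) * (n / (r + 1)) = n / (r + 1) - 1 := by field_simp
  have h6 : ((r : ℝ) + 1) / n * (n / (r + 1)) = 1 := by field_simp
  rw [h5, h6, one_pow]
  linarith

theorem adaptiveQueryNumber_div_le {n r : ℕ} (hr : 1 ≤ r) (hn : 1 ≤ n) :
    adaptiveQueryNumber n (r + 2) / ((n : ℝ) / (r + 1)) ^ (r + 1) ≤
      1 + (2 * r + 4) * 2 ^ r * ((r : ℝ) + 1) ^ (r + 1) / n := by
  have hn1 : (1 : ℝ) ≤ n := by exact_mod_cast hn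
  have hn0 : (0 : ℝ) < n := by linarith
  rw [div_le_iff₀ (by positivity)]
  refine (adaptiveQueryNumber_le n hr).trans ?_
  -- Bounding `n + 1` by `2 * n` makes the error a pure power of `n`, one degree below the main
  -- term.
  have h1 : ((n : ℝ) + 1) ^ r ≤ (2 * n) ^ r := pow_le_pow_left₀ (by positivity) (by linarith) r
  have h2 : (2 * r + 4) * 2 ^ r * ((r : ℝ) + 1) ^ (r + 1) / n * ((n : ℝ) / (r + 1)) ^ (r + 1) =
      (2 * r + 4) * (2 * n) ^ r := by
    rw [div_pow, mul_pow, pow_succ (n : ℝ) r]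
    field_simp
  rw [add_mul (1 : ℝ), one_mul, h2]
  gcongr

theorem theorem1p5 (k : ℕ) (hk : 3 ≤ k) :
    (fun n : ℕ => (adaptiveQueryNumber n k : ℝ)) ~[atTop]
      (fun n : ℕ => ((n : ℝ) / ((k : ℝ) - 1)) ^ (k - 1)) := by
  obtain ⟨r, rfl⟩ : ∃ r, k = r + 2 := ⟨k - 2, by omega⟩
  have hr : 1 ≤ r := by omega
  have hcast : (((r + 2 : ℕ) : ℝ) - 1) = (r : ℝ) + 1 := by push_cast; ring
  rw [hcast, show r + 2 - 1 = r + 1 by omega]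
  refine (isEquivalent_iff_tendsto_one ?_).2 ?_
  · filter_upwards [eventually_ge_atTop 1] with n hn
    have : (0 : ℝ) < n := by exact_mod_cast hn
    positivity
  have hlow : Tendsto (fun n : ℕ => (1 - ((r : ℝ) + 1) / n) ^ (r + 1) -
      (((r : ℝ) + 1) / n) ^ (r + 1)) atTop (nhds 1) := by
    have h := tendsto_const_div_atTop_nhds_zero_nat ((r : ℝ) + 1)
    simpa using ((h.const_sub 1).pow (r + 1)).sub (h.pow (r + 1))
  have hup : Tendsto (fun n : ℕ => 1 + (2 * r + 4) * 2 ^ r * ((r : ℝ) + 1) ^ (r + 1) / n)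
      atTop (nhds 1) := by
    simpa using (tendsto_const_div_atTop_nhds_zero_nat
      ((2 * r + 4) * 2 ^ r * ((r : ℝ) + 1) ^ (r + 1))).const_add 1
  refine tendsto_of_tendsto_of_tendsto_of_le_of_le' hlow hup ?_ ?_
  · filter_upwards [eventually_ge_atTop (2 * (r + 1))] with n hn
    exact le_adaptiveQueryNumber_div hr hn
  · filter_upwards [eventually_ge_atTop 1] with n hn
    exact adaptiveQueryNumber_div_le hr hn
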